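/- Consider an $n$-bus network with conductances $G_{ml}$ and susceptances $B_{ml}$ and power flow equations $$S_l=\sum_{m=1}^n |V_l||V_m|(\cos\theta_{ml}+j\sin\theta_{ml})(G_{ml}-jB_{ml}),\qquad \theta_{ml}=\theta_m-\theta_l .$$ Let $\mathcal S\subset\mathbb C^n$ be a set of complex injections on which the power flow equations are solvable, with a chosen solution $S\mapsto(|V|,\theta)$, and let $U$ be a set of buses (possibly all) such that the projection of $\mathcal S$ to the real powers $P=(\mathrm{Re}\,S_u)_{u\in U}$ is a nonempty box $\mathcal P=\{P: P^{\min}\le P\le P^{\max}\}$. Fix a bus $l$ and assume that on $\mathcal S$ the voltage magnitude at bus $l$ is a function $|V_l|(P)$ of $P\in\mathcal P$. Let $k$ be a continuous positive semidefinite kernel on $\mathcal P$ (for instance the squared exponential kernel), and assume that $|V_l|$ lies in the reproducing kernel Hilbert space of $k$, with norm $\||V_l|\|_k$. Let $\sigma>0$. For samples $(P^1,y^1),\dots,(P^i,y^i)$ let $$\mu_i(P)=k_i(P)^T(K_i+\sigma^2I)^{-1}(y^1,\dots,y^i)^T,\qquad \sigma_i^2(P)=k(P,P)-k_i(P)^T(K_i+\sigma^2I)^{-1}k_i(P)$$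 be the Gaussian process posterior mean and variance, where $K_i=(k(P^a,P^b))_{a,b\le i}$ and $k_i(P)=(k(P,P^a))_{a\le i}$. Let $\gamma_N=\max \tfrac12\log\det(I+\sigma^{-2}K_N)$ be the maximum information gain, the maximum being over all $P^1,\dots,P^N\in\mathcal P$. Let $\delta\in(0,1)$ and $N\ge 2\delta$ (that is, $N\ge2$, or $N=1$ and $\delta\le\frac12$), and put $$\beta_{i+1}=2\||V_l|\|_k^2+300\,\gamma_N\ln^3(i/\delta),\qquad i\ge1 .$$ Run $N$ steps of GP-UCB sampling: $P^1\in\mathcal P$ is an arbitrary, possibly random, point; for $1\le i<N$, $P^{i+1}$ is a maximizer over $\mathcal P$ of $\mu_i(P)+\sqrt{\beta_{i+1}}\,\sigma_i(P)$, or, if that maximizer has already been sampled, any point of $\mathcal P$ chosen (possibly at random) from the history; and the observations are $y^i=|V_l|(P^i)+\varepsilon^i$. The noise is either i.i.d. $\mathcal N(0,\sigma^2)$ with each $\varepsilon^i$ independent of the history (earlier noise and the choice of $P^1,\dots,P^i$), or satisfies $|\varepsilon^i|\le\sigma$ almost surely and has zero mean conditionally on that history. Then, for every outcome, the maximum $\xi_{\max}=\max_{P\in\mathcal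 P}\sqrt{\beta_{N+1}}\,\sigma_N(P)$ exists, and with probability at least $1-\delta$ $$\mu_N(P)-\xi_{\max}\le |V_l|(P)\le\mu_N(P)+\xi_{\max}\qquad\text{for all }P\in\mathcal P .$$ -/

import Mathlib

open MeasureTheory ProbabilityTheory

noncomputable section

namespace NPPLF

/-! ### Power flow -/

/-- Complex power injection at bus `l` of an `n`-bus network with conductances `G` and
susceptances `B`, for voltage magnitudes `Vm` and angles `θ`:
`S_l = ∑ m, |V_l||V_m| (cos θ_ml + j sin θ_ml) (G_ml - j B_ml)`, with `θ_ml = θ_m - θ_l`. -/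
def powerInjection {n : ℕ} (G B : Matrix (Fin n) (Fin n) ℝ) (Vm θ : Fin n → ℝ) (l : Fin n) : ℂ :=
  ∑ m, ((Vm l * Vm m : ℝ) : ℂ) *
    ((Real.cos (θ m - θ l) : ℂ) + Complex.I * (Real.sin (θ m - θ l) : ℂ)) *
    ((G m l : ℂ) - Complex.I * (B m l : ℂ))

/-- The real power injections at the uncertain buses `bus i`, `i : ι`. -/
def realInjection {n : ℕ} {ι : Type*} (bus : ι ↪ Fin n) (S : Fin n → ℂ) : ι → ℝ :=
  fun i => (S (bus i)).re

/-- `V` is the voltage magnitude at bus `l` as a function of the real power injections `P ∈ D`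
at the uncertain buses, on the set `𝒮` of complex injections: the power flow equations are
solvable at every `S ∈ 𝒮` (an inverse power flow map `S ↦ (Vm S, θ S)` is given on `𝒮`), and the
solution's magnitude at bus `l` is `V` at the real part of `S`. -/
def IsInverseVoltageMagnitude {n : ℕ} {ι : Type*} (G B : Matrix (Fin n) (Fin n) ℝ)
    (bus : ι ↪ Fin n) (𝒮 : Set (Fin n → ℂ)) (l : Fin n) {D : Set (ι → ℝ)} (V : D → ℝ) : Prop :=
  ∃ Vm θ : (Fin n → ℂ) → Fin n → ℝ,
    (∀ S ∈ 𝒮, (∀ m, 0 ≤ Vm S m) ∧ ∀ m, powerInjection G B (Vm S) (θ S) m = S m) ∧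
    ∀ S ∈ 𝒮, ∀ hS : realInjection bus S ∈ D, V ⟨realInjection bus S, hS⟩ = Vm S l

/-! ### Gaussian process regression -/

variable {X : Type*}

/-- Kernel matrix `k(X, X)` of a list of training points. -/
def gram (k : X → X → ℝ) {m : ℕ} (xs : Fin m → X) : Matrix (Fin m) (Fin m) ℝ :=
  Matrix.of fun a b => k (xs a) (xs b)

/-- Posterior mean `k(x, X)ᵀ (k(X, X) + σ² I)⁻¹ y`. -/
def posteriorMean (k : X → X → ℝ) (σ : ℝ) {m : ℕ} (xs : Fin m → X) (ys : Fin m → ℝ) (x : X) : ℝ :=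
  (fun a => k x (xs a)) ⬝ᵥ Matrix.mulVec (gram k xs + σ ^ 2 • (1 : Matrix (Fin m) (Fin m) ℝ))⁻¹ ys

/-- Posterior variance `k(x, x) - k(x, X)ᵀ (k(X, X) + σ² I)⁻¹ k(x, X)`. -/
def posteriorVar (k : X → X → ℝ) (σ : ℝ) {m : ℕ} (xs : Fin m → X) (x : X) : ℝ :=
  k x x - (fun a => k x (xs a)) ⬝ᵥ
    Matrix.mulVec (gram k xs + σ ^ 2 • (1 : Matrix (Fin m) (Fin m) ℝ))⁻¹ (fun a => k x (xs a))

/-- Posterior standard deviation. -/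
def posteriorStd (k : X → X → ℝ) (σ : ℝ) {m : ℕ} (xs : Fin m → X) (x : X) : ℝ :=
  Real.sqrt (posteriorVar k σ xs x)

/-- Maximum information gain `γ_m` from `m` noisy observations: the supremum over `m`-tuples of
points of `½ log det (I + σ⁻² k(X, X))`. -/
def maxInfoGain (k : X → X → ℝ) (σ : ℝ) (m : ℕ) : ℝ :=
  ⨆ xs : Fin m → X,
    (1 / 2 : ℝ) * Real.log (1 + (σ ^ 2)⁻¹ • gram k xs : Matrix (Fin m) (Fin m) ℝ).det

/-- The confidence parameter `β_{i+1} = 2 ‖f‖² + 300 γ ln³(i / δ)`, for `fnorm = ‖f‖`.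
(`betaSucc fnorm γ δ i` is `β` with index `i + 1`.) -/
def betaSucc (fnorm γ δ : ℝ) (i : ℕ) : ℝ :=
  2 * fnorm ^ 2 + 300 * γ * Real.log ((i : ℝ) / δ) ^ 3

/-- The first `i` terms `z 1, …, z i` of a sequence (numbered from `1`). -/
def firstTerms {Z : Type*} (z : ℕ → Z) (i : ℕ) : Fin i → Z := fun j => z (j.val + 1)

/-- Posterior mean `μ_i` after the samples `(x 1, y 1), …, (x i, y i)`. -/
def meanAfter (k : X → X → ℝ) (σ : ℝ) (x : ℕ → X) (y : ℕ → ℝ) (i : ℕ) (p : X) : ℝ :=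
  posteriorMean k σ (firstTerms x i) (firstTerms y i) p

/-- Posterior standard deviation `σ_i` after sampling at `x 1, …, x i`. -/
def stdAfter (k : X → X → ℝ) (σ : ℝ) (x : ℕ → X) (i : ℕ) (p : X) : ℝ :=
  posteriorStd k σ (firstTerms x i) p

/-- The probabilistic learning bound `ξ_max = max_p √β σ_N(p)`. -/
def learningBound (k : X → X → ℝ) (σ β : ℝ) (x : ℕ → X) (N : ℕ) : ℝ :=
  ⨆ p : X, Real.sqrt β * stdAfter k σ x N p

/-! ### Noise and sampling -/

variable {Ω : Type*} [mΩ : MeasurableSpace Ω]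

/-- The noise terms `ε 1, …, ε N` are i.i.d. `N(0, σ²)`, each independent of the history. -/
def IsGaussianNoise (μ : Measure Ω) (ℱ : Filtration ℕ mΩ) (σ : ℝ) (N : ℕ) (ε : ℕ → Ω → ℝ) : Prop :=
  ∀ i < N, Measurable[ℱ (i + 1)] (ε (i + 1)) ∧
    μ.map (ε (i + 1)) = gaussianReal 0 (Real.toNNReal (σ ^ 2)) ∧
    Indep (MeasurableSpace.comap (ε (i + 1)) inferInstance) (ℱ i) μ

/-- The noise terms `ε 1, …, ε N` have zero mean conditionally on the history and are almost
surely bounded by `σ` in absolute value. -/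
def IsBoundedNoise (μ : Measure Ω) (ℱ : Filtration ℕ mΩ) (σ : ℝ) (N : ℕ) (ε : ℕ → Ω → ℝ) : Prop :=
  ∀ i < N, Measurable[ℱ (i + 1)] (ε (i + 1)) ∧
    (∀ᵐ ω ∂μ, |ε (i + 1) ω| ≤ σ) ∧
    μ[ε (i + 1) | ℱ i] =ᵐ[μ] 0

/-- `N` steps of GP-UCB sampling of `f`, with query points `x 1, …, x N`, observations
`y 1, …, y N`, noise `ε 1, …, ε N` and `β (i + 1) = betaS i`. The `σ`-algebra `ℱ i` is the history
after `i` samples, including the randomness used to choose the next point. -/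
structure IsGPUCBRun [MeasurableSpace X] (k : X → X → ℝ) (σ : ℝ) (betaS : ℕ → ℝ) (f : X → ℝ)
    (ℱ : Filtration ℕ mΩ) (N : ℕ) (x : ℕ → Ω → X) (y ε : ℕ → Ω → ℝ) : Prop where
  /-- Each point (the first one is an arbitrary random point) is chosen from the history. -/
  measurable_query : ∀ i < N, Measurable[ℱ i] (x (i + 1))
  /-- Each observation is a noisy value of `f`. -/
  observe : ∀ i < N, ∀ ω, y (i + 1) ω = f (x (i + 1) ω) + ε (i + 1) ω
  /-- The next point maximizes `μ_i + √β_{i+1} σ_i`; when the maximizer is already among the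
  sampled points, the next point may be chosen arbitrarily instead. -/
  select : ∀ i, 1 ≤ i → i < N → ∀ ω, ∃ z : X,
    IsMaxOn (fun p => meanAfter k σ (fun j => x j ω) (fun j => y j ω) i p +
      Real.sqrt (betaS i) * stdAfter k σ (fun j => x j ω) i p) Set.univ z ∧
    (x (i + 1) ω = z ∨ ∃ j, 1 ≤ j ∧ j ≤ i ∧ x j ω = z)

end NPPLF

end

/-!
The assertion is a uniform confidence bound for kernel ridge regression with adaptively chosen
points; only the predictability of the points matters, not the rule that selects them.

Write `Φ` for the feature map of the reproducing kernel Hilbert space, `K` for the kernel matrix of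
the samples and `e` for the noise divided by `σ`. Cauchy-Schwarz in `H × ℝᴺ`
(`prediction_error_sq_le`) gives, for every point `p` and every outcome,
`(μ_N(p) - V(p))² ≤ σ_N(p)² (2 ‖f‖² + 2 Q)`, where `Q` is the form `eᵀ K₁ (K₁ + 1)⁻¹ e` of the
matrix `K₁ = σ⁻² K` (`explainedEnergy`). It remains to show that `Q ≤ 12 γ (1 + log (1 / δ))` with
probability at least `1 - δ`; since `log (N / δ) ≥ log 2`, twice this is at most
`300 γ log³ (N / δ)` (`two_mul_energy_le_betaSucc`).

For a fixed scale `c > 0` let `Q_c` be the same form for `c K₁`. The process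
`exp (Q_c / 2) / √det (c K₁ + 1)` is a supermartingale: by block elimination
(`selfNormExp_succ`) its growth factor is
`exp ((e² - (e - m)² / (1 + s²)) / 2) / √(1 + s²)`, with `m` and `s²` the posterior mean and variance
at the new point, and this is the average of `exp (h e - h² / 2)` over `h ∼ N(m, s²)`
(`lintegral_exp_mixture`). Each of these exponentials has conditional expectation at most `1`,
since Gaussian noise, and by Hoeffding's argument bounded centred noise, is conditionally
sub-Gaussian. Markov's inequality yields `Q_c ≤ log det (c K₁ + 1) + 2 log (1 / δ)` with probability
at least `1 - δ` (`measure_explainedEnergy_gt_le`).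

With `c = 1` the deviation term `2 log (1 / δ)` is not proportional to `γ`, as the statement
requires when `γ` is small. The eigenvalues of `K₁` are at most `exp (2 γ) - 1`, so for
`0 < 2 γ < 1` the scale `c = 1 / (2 γ)` keeps `c K₁` bounded by `2`, and `Q ≤ 6 γ Q_c` with
`log det (c K₁ + 1) ≤ 2` (`sum_le_of_mixtureScale`); for `γ = 0` the matrix `K₁` vanishes. The scale
depends on `γ` alone, so it is not random.
-/

namespace NPPLF

open Matrix
open scoped RealInnerProductSpace ENNReal

/-! ### Quadratic forms of inverse matrices -/

/-- The quadratic form `eᵀ K (K + 1)⁻¹ e`, written as `eᵀ e - eᵀ (K + 1)⁻¹ e`. -/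
noncomputable def explainedEnergy {m : ℕ} (K : Matrix (Fin m) (Fin m) ℝ) (e : Fin m → ℝ) : ℝ :=
  e ⬝ᵥ e - e ⬝ᵥ (K + 1)⁻¹ *ᵥ e

lemma det_succ_eq_mul_schur {n : ℕ} (A : Matrix (Fin (n + 1)) (Fin (n + 1)) ℝ)
    (h0 : IsUnit (A.submatrix Fin.castSucc Fin.castSucc).det) :
    A.det = (A.submatrix Fin.castSucc Fin.castSucc).det *
      (A (Fin.last n) (Fin.last n) - (fun j => A (Fin.last n) (Fin.castSucc j)) ⬝ᵥ
        (A.submatrix Fin.castSucc Fin.castSucc)⁻¹ *ᵥ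
          (fun j => A (Fin.castSucc j) (Fin.last n))) := by
  set A0 := A.submatrix Fin.castSucc Fin.castSucc with hA0
  have hb : A.submatrix (finSumFinEquiv (m := n) (n := 1)) finSumFinEquiv =
      Matrix.fromBlocks A0 (Matrix.of fun i _ => A (Fin.castSucc i) (Fin.last n))
        (Matrix.of fun _ j => A (Fin.last n) (Fin.castSucc j))
        (Matrix.of fun _ _ => A (Fin.last n) (Fin.last n)) := by
    ext i j
    rcases i with i | i <;> rcases j with j | j
    · rfl
    · fin_cases j; rfl
    · fin_cases i; rfl
    · fin_cases i; fin_cases j; rfl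
  rw [← Matrix.det_submatrix_equiv_self (finSumFinEquiv (m := n) (n := 1)) A, hb]
  let := A0.invertibleOfIsUnitDet h0
  rw [Matrix.det_fromBlocks₁₁, Matrix.det_fin_one]
  simp only [Matrix.invOf_eq_nonsing_inv, Matrix.sub_apply, Matrix.of_apply, Matrix.mul_assoc]
  rfl

/-- Block elimination for the inverse quadratic form: adding one coordinate adds the squared
innovation of that coordinate divided by the Schur complement. -/
lemma dotProduct_inv_mulVec_succ {n : ℕ} (A : Matrix (Fin (n + 1)) (Fin (n + 1)) ℝ)
    (hsymm : A.IsSymm) (h0 : IsUnit (A.submatrix Fin.castSucc Fin.castSucc).det)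
    (h : IsUnit A.det) (e : Fin (n + 1) → ℝ) (e0 b : Fin n → ℝ) (s : ℝ) (hs0 : s ≠ 0)
    (he0 : e0 = fun j => e (Fin.castSucc j)) (hb : b = fun j => A (Fin.last n) (Fin.castSucc j))
    (hs : s = A (Fin.last n) (Fin.last n) -
      b ⬝ᵥ (A.submatrix Fin.castSucc Fin.castSucc)⁻¹ *ᵥ b) :
    e ⬝ᵥ A⁻¹ *ᵥ e = e0 ⬝ᵥ (A.submatrix Fin.castSucc Fin.castSucc)⁻¹ *ᵥ e0 +
      (e (Fin.last n) - b ⬝ᵥ (A.submatrix Fin.castSucc Fin.castSucc)⁻¹ *ᵥ e0) ^ 2 / s := by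
  set A0 := A.submatrix Fin.castSucc Fin.castSucc with hA0
  have hA0s : A0⁻¹ᵀ = A0⁻¹ := by
    rw [Matrix.transpose_nonsing_inv, hA0, Matrix.transpose_submatrix, hsymm.eq]
  set t := (e (Fin.last n) - b ⬝ᵥ A0⁻¹ *ᵥ e0) / s with ht
  have hts : t * s = e (Fin.last n) - b ⬝ᵥ A0⁻¹ *ᵥ e0 := by rw [ht]; field_simp
  -- the solution of `A v = e`, by elimination
  set v0 : Fin n → ℝ := A0⁻¹ *ᵥ e0 - t • A0⁻¹ *ᵥ b with hv0
  set v : Fin (n + 1) → ℝ := Fin.snoc v0 t with hv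
  have hA0v : A0 *ᵥ v0 = e0 - t • b := by
    rw [hv0, Matrix.mulVec_sub, Matrix.mulVec_smul, Matrix.mulVec_mulVec, Matrix.mulVec_mulVec,
      Matrix.mul_nonsing_inv _ h0, Matrix.one_mulVec, Matrix.one_mulVec]
  have hAv : A *ᵥ v = e := by
    ext i
    refine Fin.lastCases ?_ (fun i => ?_) i
    · have h1 : (A *ᵥ v) (Fin.last n) = b ⬝ᵥ v0 + A (Fin.last n) (Fin.last n) * t := by
        simp [Matrix.mulVec, dotProduct, Fin.sum_univ_castSucc, hv, hb]
      rw [h1, hv0, dotProduct_sub, dotProduct_smul, smul_eq_mul]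
      linear_combination hts - t * hs
    · have h1 : (A *ᵥ v) (Fin.castSucc i) = (A0 *ᵥ v0) i + t * b i := by
        simp only [Matrix.mulVec, dotProduct, Fin.sum_univ_castSucc, hv, hb, hA0,
          Fin.snoc_castSucc, Fin.snoc_last, Matrix.submatrix_apply]
        rw [hsymm.apply (Fin.last n) (Fin.castSucc i), mul_comm t]
      rw [h1, hA0v, he0]
      simp
  have hinv : A⁻¹ *ᵥ e = v := by
    rw [← hAv, Matrix.mulVec_mulVec, Matrix.nonsing_inv_mul _ h, Matrix.one_mulVec]
  have hsum : e ⬝ᵥ v = e0 ⬝ᵥ v0 + e (Fin.last n) * t := by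
    simp [dotProduct, Fin.sum_univ_castSucc, hv, he0]
  have hcross : e0 ⬝ᵥ A0⁻¹ *ᵥ b = b ⬝ᵥ A0⁻¹ *ᵥ e0 := by
    rw [Matrix.dotProduct_mulVec, ← Matrix.mulVec_transpose, hA0s, dotProduct_comm]
  rw [hinv, hsum, hv0, dotProduct_sub, dotProduct_smul, smul_eq_mul, hcross, ht]
  field_simp
  ring

/-- Simultaneous diagonalization of the forms `explainedEnergy (c • K)` and the determinants
`det (c • K + 1)` over all scales `c ≥ 0`; `lam` are the eigenvalues of `K` and `z` the coordinates
of `e` in an eigenbasis. -/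
lemma exists_spectral_explainedEnergy {m : ℕ} {K : Matrix (Fin m) (Fin m) ℝ} (hK : K.PosSemidef)
    (e : Fin m → ℝ) :
    ∃ lam z : Fin m → ℝ, (∀ i, 0 ≤ lam i) ∧ ∀ c : ℝ, 0 ≤ c →
      (c • K + 1).det = ∏ i, (1 + c * lam i) ∧
      explainedEnergy (c • K) e = ∑ i, z i ^ 2 * (c * lam i / (1 + c * lam i)) := by
  set U : Matrix (Fin m) (Fin m) ℝ := (hK.1.eigenvectorUnitary : Matrix (Fin m) (Fin m) ℝ)
    with hU
  have hU1 : U * star U = 1 := Unitary.coe_mul_star_self hK.1.eigenvectorUnitary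
  have hU2 : star U * U = 1 := Unitary.coe_star_mul_self hK.1.eigenvectorUnitary
  set lam := hK.1.eigenvalues with hlam
  have hspec : K = U * Matrix.diagonal lam * star U := by
    have := hK.1.spectral_theorem
    rw [Unitary.conjStarAlgAut_apply] at this
    exact this
  refine ⟨lam, star U *ᵥ e, hK.eigenvalues_nonneg, fun c hc => ?_⟩
  have hpos : ∀ i, 0 < 1 + c * lam i := fun i => by
    have := mul_nonneg hc (hK.eigenvalues_nonneg i)
    linarith
  have hA : c • K + 1 = U * Matrix.diagonal (fun i => 1 + c * lam i) * star U := by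
    have : Matrix.diagonal (fun i => 1 + c * lam i) = 1 + c • Matrix.diagonal lam := by
      ext i j
      by_cases hij : i = j <;> simp [hij]
    rw [this, Matrix.mul_add, Matrix.add_mul, Matrix.mul_one, hU1, Matrix.mul_smul,
      Matrix.smul_mul, ← hspec, add_comm]
  have hinv : (c • K + 1)⁻¹ = U * Matrix.diagonal (fun i => (1 + c * lam i)⁻¹) * star U := by
    refine Matrix.inv_eq_right_inv ?_
    rw [hA]
    calc _ = U * Matrix.diagonal (fun i => 1 + c * lam i) * (star U * U) *
          Matrix.diagonal (fun i => (1 + c * lam i)⁻¹) * star U := by simp only [Matrix.mul_assoc]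
      _ = 1 := by
        rw [hU2, Matrix.mul_one, Matrix.mul_assoc U, Matrix.diagonal_mul_diagonal]
        have : (fun i => (1 + c * lam i) * (1 + c * lam i)⁻¹) = fun _ : Fin m => (1 : ℝ) :=
          funext fun i => mul_inv_cancel₀ (hpos i).ne'
        rw [this, Matrix.diagonal_one, Matrix.mul_one, hU1]
  have hz : ∀ w : Fin m → ℝ, e ⬝ᵥ U *ᵥ w = (star U *ᵥ e) ⬝ᵥ w := fun w => by
    rw [Matrix.dotProduct_mulVec, ← Matrix.mulVec_transpose, Matrix.star_eq_conjTranspose,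
      Matrix.conjTranspose_eq_transpose_of_trivial]
  constructor
  · rw [hA, Matrix.det_mul, Matrix.det_mul, mul_comm U.det, mul_assoc, ← Matrix.det_mul, hU1,
      Matrix.det_one, mul_one, Matrix.det_diagonal]
  · have h1 : e ⬝ᵥ e = (star U *ᵥ e) ⬝ᵥ (star U *ᵥ e) := by
      rw [← hz, Matrix.mulVec_mulVec, hU1, Matrix.one_mulVec]
    rw [explainedEnergy, hinv, h1, Matrix.mul_assoc, ← Matrix.mulVec_mulVec, hz,
      ← Matrix.mulVec_mulVec]
    simp only [dotProduct, Matrix.mulVec_diagonal]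
    rw [← Finset.sum_sub_distrib]
    refine Finset.sum_congr rfl fun i _ => ?_
    have := (hpos i).ne'
    field_simp
    ring

/-! ### The scale of the mixture -/

lemma one_add_sum_le_prod_one_add {ι : Type*} (s : Finset ι) (a : ι → ℝ) (ha : ∀ i, 0 ≤ a i) :
    1 + ∑ i ∈ s, a i ≤ ∏ i ∈ s, (1 + a i) := by
  classical
  induction s using Finset.induction_on with
  | empty => simp
  | insert i s hi ih =>
    rw [Finset.sum_insert hi, Finset.prod_insert hi]
    nlinarith [mul_nonneg (ha i) (Finset.sum_nonneg fun j (_ : j ∈ s) => ha j), ha i,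
      mul_le_mul_of_nonneg_left ih (ha i)]

/-- The scale of the Gaussian mixture for twice the information gain `t`: when `t` is small, the
prior has to be inflated so that the deviation term is also of order `t`. -/
noncomputable def mixtureScale (t : ℝ) : ℝ := if 0 < t ∧ t < 1 then t⁻¹ else 1

lemma mixtureScale_pos (t : ℝ) : 0 < mixtureScale t := by
  unfold mixtureScale
  split_ifs with h
  · exact inv_pos.2 h.1
  · exact one_pos

/-- A bound on the rescaled form that contains an additive deviation `2 L` becomes, at scale one,
a bound proportional to `t`. -/
lemma sum_le_of_mixtureScale {m : ℕ} (lam z : Fin m → ℝ) (hlam : ∀ i, 0 ≤ lam i) {t L : ℝ}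
    (ht : 0 ≤ t) (hL : 0 ≤ L) (hprod : ∏ i, (1 + lam i) ≤ Real.exp t)
    (h : ∑ i, z i ^ 2 * (mixtureScale t * lam i / (1 + mixtureScale t * lam i)) ≤
      Real.log (∏ i, (1 + mixtureScale t * lam i)) + 2 * L) :
    ∑ i, z i ^ 2 * (lam i / (1 + lam i)) ≤ 6 * t * (1 + L) := by
  have hsum : ∑ i, lam i ≤ Real.exp t - 1 := by
    have := one_add_sum_le_prod_one_add Finset.univ lam hlam
    linarith
  have hle : ∀ i, lam i ≤ Real.exp t - 1 := fun i =>
    (Finset.single_le_sum (fun j _ => hlam j) (Finset.mem_univ i)).trans hsum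
  have hpp : ∀ c : ℝ, 0 ≤ c → 0 < ∏ i, (1 + c * lam i) := fun c hc =>
    Finset.prod_pos fun i _ => by have := mul_nonneg hc (hlam i); linarith
  rcases ht.eq_or_lt with rfl | htpos
  · have h0 : ∀ i, lam i = 0 := fun i => le_antisymm (by simpa using hle i) (hlam i)
    simp [h0]
  by_cases ht1 : t < 1
  · have hc : mixtureScale t = t⁻¹ := if_pos ⟨htpos, ht1⟩
    rw [hc] at h
    have hexp : Real.exp t - 1 ≤ 2 * t := by
      have := Real.abs_exp_sub_one_le (x := t) (by rw [abs_of_pos htpos]; exact ht1.le)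
      rw [abs_of_pos htpos] at this
      exact (le_abs_self _).trans this
    have hinv : (0 : ℝ) < t⁻¹ := inv_pos.2 htpos
    have hlog : Real.log (∏ i, (1 + t⁻¹ * lam i)) ≤ 2 := by
      rw [Real.log_prod fun i _ => by have := mul_nonneg hinv.le (hlam i); positivity]
      calc ∑ i, Real.log (1 + t⁻¹ * lam i) ≤ ∑ i, t⁻¹ * lam i := by
            refine Finset.sum_le_sum fun i _ => ?_
            have h1 := mul_nonneg hinv.le (hlam i)
            have := Real.log_le_sub_one_of_pos (x := 1 + t⁻¹ * lam i) (by linarith)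
            linarith
        _ = t⁻¹ * ∑ i, lam i := by rw [Finset.mul_sum]
        _ ≤ t⁻¹ * (2 * t) := by gcongr; linarith
        _ = 2 := by field_simp
    calc ∑ i, z i ^ 2 * (lam i / (1 + lam i))
        ≤ ∑ i, 3 * t * (z i ^ 2 * (t⁻¹ * lam i / (1 + t⁻¹ * lam i))) := by
          refine Finset.sum_le_sum fun i _ => ?_
          rw [mul_left_comm]
          refine mul_le_mul_of_nonneg_left ?_ (sq_nonneg _)
          -- `t⁻¹ * lam i ≤ 2`, so the denominator on the right is at most `3`
          have h1 := hlam i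
          have h2 : lam i ≤ 2 * t := (hle i).trans hexp
          have h3 : 3 * t * (t⁻¹ * lam i / (1 + t⁻¹ * lam i)) = 3 * t * lam i / (t + lam i) := by
            field_simp
          rw [h3, div_le_div_iff₀ (by linarith) (by linarith)]
          nlinarith [mul_nonneg h1 h1, mul_nonneg h1 (sub_nonneg.2 h2), mul_nonneg h1 ht,
            mul_nonneg (mul_nonneg h1 h1) ht]
      _ = 3 * t * ∑ i, z i ^ 2 * (t⁻¹ * lam i / (1 + t⁻¹ * lam i)) := by rw [Finset.mul_sum]
      _ ≤ 3 * t * (2 + 2 * L) := by gcongr; linarith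
      _ = 6 * t * (1 + L) := by ring
  · have hc : mixtureScale t = 1 := if_neg fun h => ht1 h.2
    simp only [hc, one_mul] at h
    have hlog : Real.log (∏ i, (1 + lam i)) ≤ t := by
      rw [← Real.log_exp t]
      exact Real.log_le_log (by simpa using hpp 1 zero_le_one) hprod
    nlinarith [mul_nonneg ht hL, not_lt.1 ht1]

/-! ### Error of the posterior mean -/

section Prediction

variable {X H : Type*} [NormedAddCommGroup H] [InnerProductSpace ℝ H]

lemma posSemidef_gram_of_inner {k : X → X → ℝ} {Φ : X → H} (hk : ∀ x y, k x y = ⟪Φ x, Φ y⟫)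
    {m : ℕ} (xs : Fin m → X) : (gram k xs).PosSemidef := by
  have : gram k xs = Matrix.gram ℝ (Φ ∘ xs) := by
    ext a b
    simp [gram, hk]
  rw [this]
  exact Matrix.posSemidef_gram ℝ _

lemma posDef_gram_add_smul_one {k : X → X → ℝ} {Φ : X → H} (hk : ∀ x y, k x y = ⟪Φ x, Φ y⟫)
    {m : ℕ} (xs : Fin m → X) {r : ℝ} (hr : 0 < r) :
    (gram k xs + r • (1 : Matrix (Fin m) (Fin m) ℝ)).PosDef :=
  Matrix.PosDef.posSemidef_add (posSemidef_gram_of_inner hk xs) (Matrix.PosDef.one.smul hr)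

lemma inner_sum_smul_eq_gram {k : X → X → ℝ} {Φ : X → H} (hk : ∀ x y, k x y = ⟪Φ x, Φ y⟫)
    {m : ℕ} (xs : Fin m → X) (α u : Fin m → ℝ) :
    ⟪∑ a, α a • Φ (xs a), ∑ a, u a • Φ (xs a)⟫ = α ⬝ᵥ gram k xs *ᵥ u := by
  simp only [sum_inner, inner_sum, inner_smul_right, inner_smul_left, dotProduct, Matrix.mulVec,
    gram, hk, Finset.mul_sum, Matrix.of_apply, RCLike.conj_to_real]
  rw [Finset.sum_comm]
  exact Finset.sum_congr rfl fun i _ => Finset.sum_congr rfl fun j _ => by ring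

/-- The posterior variance is the value of the regularized least-squares problem of representing
`Φ x` by the features of the sampled points; `α` is its minimizer. -/
lemma posteriorVar_eq_norm_sq_add {k : X → X → ℝ} {Φ : X → H} (hk : ∀ x y, k x y = ⟪Φ x, Φ y⟫)
    {σ : ℝ} (hσ : 0 < σ) {m : ℕ} (xs : Fin m → X) (x : X) (α : Fin m → ℝ)
    (hα : α = (gram k xs + σ ^ 2 • (1 : Matrix (Fin m) (Fin m) ℝ))⁻¹ *ᵥ fun a => k x (xs a)) :
    posteriorVar k σ xs x = ‖Φ x - ∑ a, α a • Φ (xs a)‖ ^ 2 + σ ^ 2 * α ⬝ᵥ α := by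
  set v : Fin m → ℝ := fun a => k x (xs a) with hv
  have hA := posDef_gram_add_smul_one hk xs (r := σ ^ 2) (by positivity)
  have hAα : gram k xs *ᵥ α + σ ^ 2 • α = v := by
    have : (gram k xs + σ ^ 2 • (1 : Matrix (Fin m) (Fin m) ℝ)) *ᵥ α = v := by
      rw [hα, Matrix.mulVec_mulVec, Matrix.mul_nonsing_inv _ hA.det_pos.ne'.isUnit,
        Matrix.one_mulVec]
    rwa [Matrix.add_mulVec, Matrix.smul_mulVec, Matrix.one_mulVec] at this
  have h1 : ⟪Φ x, ∑ a, α a • Φ (xs a)⟫ = v ⬝ᵥ α := by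
    simp [inner_sum, inner_smul_right, dotProduct, hv, hk, mul_comm]
  have h2 : ‖∑ a, α a • Φ (xs a)‖ ^ 2 = α ⬝ᵥ gram k xs *ᵥ α := by
    rw [← real_inner_self_eq_norm_sq, inner_sum_smul_eq_gram hk]
  have h3 : v ⬝ᵥ α = α ⬝ᵥ gram k xs *ᵥ α + σ ^ 2 * α ⬝ᵥ α := by
    rw [dotProduct_comm, ← hAα, dotProduct_add, dotProduct_smul, smul_eq_mul]
  rw [@norm_sub_sq_real, h1, h2, posteriorVar, ← hv, ← hα, ← real_inner_self_eq_norm_sq, hk]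
  linarith

lemma posteriorVar_nonneg {k : X → X → ℝ} {Φ : X → H} (hk : ∀ x y, k x y = ⟪Φ x, Φ y⟫)
    {σ : ℝ} (hσ : 0 < σ) {m : ℕ} (xs : Fin m → X) (x : X) : 0 ≤ posteriorVar k σ xs x := by
  rw [posteriorVar_eq_norm_sq_add hk hσ xs x _ rfl]
  have : ∀ α : Fin m → ℝ, 0 ≤ α ⬝ᵥ α := fun α => Finset.sum_nonneg fun i _ => mul_self_nonneg _
  have := this ((gram k xs + σ ^ 2 • (1 : Matrix (Fin m) (Fin m) ℝ))⁻¹ *ᵥ fun a => k x (xs a))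
  positivity

/-- The regression error is at most the posterior standard deviation times a factor that depends
only on the norm of `f` and on the part of the noise energy that the kernel can explain. -/
lemma prediction_error_sq_le {k : X → X → ℝ} {Φ : X → H} (hk : ∀ x y, k x y = ⟪Φ x, Φ y⟫)
    {V : X → ℝ} (f : H) (hV : ∀ x, V x = ⟪f, Φ x⟫) {σ : ℝ} (hσ : 0 < σ) {m : ℕ} (xs : Fin m → X)
    (ys ε : Fin m → ℝ) (hy : ∀ a, ys a = V (xs a) + ε a) (x : X) :
    (posteriorMean k σ xs ys x - V x) ^ 2 ≤ posteriorVar k σ xs x *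
      (2 * ‖f‖ ^ 2 + 2 * explainedEnergy ((σ ^ 2)⁻¹ • gram k xs) (σ⁻¹ • ε)) := by
  set K := gram k xs with hK
  set A := K + σ ^ 2 • (1 : Matrix (Fin m) (Fin m) ℝ) with hAdef
  set v : Fin m → ℝ := fun a => k x (xs a) with hv
  set α := A⁻¹ *ᵥ v with hα
  set u := A⁻¹ *ᵥ ε with hu
  set w := K *ᵥ u with hw
  have hσ2 : (0 : ℝ) < σ ^ 2 := by positivity
  have hA := posDef_gram_add_smul_one hk xs hσ2
  have hdet : IsUnit A.det := hA.det_pos.ne'.isUnit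
  have hKs : Kᵀ = K := by
    have := (posSemidef_gram_of_inner hk xs).1
    rwa [Matrix.IsHermitian, Matrix.conjTranspose_eq_transpose_of_trivial] at this
  have hAs : A⁻¹ᵀ = A⁻¹ := by
    rw [Matrix.transpose_nonsing_inv, hAdef, Matrix.transpose_add, hKs, Matrix.transpose_smul,
      Matrix.transpose_one]
  have hsolve : ∀ b : Fin m → ℝ, K *ᵥ (A⁻¹ *ᵥ b) + σ ^ 2 • (A⁻¹ *ᵥ b) = b := fun b => by
    have : A *ᵥ (A⁻¹ *ᵥ b) = b := by
      rw [Matrix.mulVec_mulVec, Matrix.mul_nonsing_inv _ hdet, Matrix.one_mulVec]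
    rwa [hAdef, Matrix.add_mulVec, Matrix.smul_mulVec, Matrix.one_mulVec, ← hAdef] at this
  have hu' : w + σ ^ 2 • u = ε := hsolve ε
  have hα' : K *ᵥ α + σ ^ 2 • α = v := hsolve v
  set r := Φ x - ∑ a, α a • Φ (xs a) with hr
  set g := ∑ a, u a • Φ (xs a) with hg
  have hgn : ‖g‖ ^ 2 = u ⬝ᵥ w := by
    rw [← real_inner_self_eq_norm_sq, hg, inner_sum_smul_eq_gram hk]
  have hKsym : (K *ᵥ α) ⬝ᵥ u = α ⬝ᵥ w := by
    rw [hw, Matrix.dotProduct_mulVec α, ← Matrix.mulVec_transpose, hKs]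
  have hrg : ⟪r, g⟫ = σ ^ 2 * α ⬝ᵥ u := by
    have h1 : ⟪Φ x, g⟫ = v ⬝ᵥ u := by
      simp [hg, inner_sum, inner_smul_right, dotProduct, hv, hk, mul_comm]
    have h2 : ⟪∑ a, α a • Φ (xs a), g⟫ = α ⬝ᵥ w := by
      rw [hg, inner_sum_smul_eq_gram hk]
    rw [hr, inner_sub_left, h1, h2, ← hα', add_dotProduct, smul_dotProduct, hKsym, smul_eq_mul]
    ring
  have henergy : explainedEnergy ((σ ^ 2)⁻¹ • K) (σ⁻¹ • ε) = ‖g‖ ^ 2 + (σ ^ 2)⁻¹ * w ⬝ᵥ w := by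
    have hinv : ((σ ^ 2)⁻¹ • K + 1)⁻¹ = σ ^ 2 • A⁻¹ := by
      refine Matrix.inv_eq_right_inv ?_
      have : (σ ^ 2)⁻¹ • K + 1 = (σ ^ 2)⁻¹ • A := by
        rw [hAdef, smul_add, smul_smul, inv_mul_cancel₀ hσ2.ne', one_smul]
      rw [this, Matrix.smul_mul, Matrix.mul_smul, smul_smul, inv_mul_cancel₀ hσ2.ne', one_smul,
        Matrix.mul_nonsing_inv _ hdet]
    rw [explainedEnergy, hinv, Matrix.mulVec_smul, Matrix.smul_mulVec, ← hu, hgn]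
    simp only [dotProduct_smul, smul_dotProduct, smul_eq_mul]
    rw [← hu']
    simp only [dotProduct_add, add_dotProduct, dotProduct_smul, smul_dotProduct, smul_eq_mul,
      dotProduct_comm w u]
    field_simp
    ring
  have herr : posteriorMean k σ xs ys x - V x = ⟪r, g - f⟫ + α ⬝ᵥ w := by
    have h1 : posteriorMean k σ xs ys x = α ⬝ᵥ ys := by
      rw [posteriorMean, ← hK, ← hAdef, ← hv, Matrix.dotProduct_mulVec, ← Matrix.mulVec_transpose,
        hAs]
    have h2 : α ⬝ᵥ ys = ⟪f, ∑ a, α a • Φ (xs a)⟫ + α ⬝ᵥ ε := by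
      simp [dotProduct, hy, hV, mul_add, Finset.sum_add_distrib, inner_sum, inner_smul_right]
    rw [h1, h2, inner_sub_right, hrg, real_inner_comm f r, hr, inner_sub_right, hV x, ← hu',
      dotProduct_add, dotProduct_smul, smul_eq_mul]
    ring
  have hvar := posteriorVar_eq_norm_sq_add hk hσ xs x α hα
  rw [← hr] at hvar
  rw [herr, hvar, henergy]
  have hcs1 : ⟪r, g - f⟫ ^ 2 ≤ ‖r‖ ^ 2 * ‖g - f‖ ^ 2 := by
    rw [← mul_pow]
    exact sq_le_sq.2 ((abs_real_inner_le_norm _ _).trans (le_abs_self _))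
  have hcs2 : (α ⬝ᵥ w) ^ 2 ≤ (α ⬝ᵥ α) * (w ⬝ᵥ w) := by
    simpa [dotProduct, sq] using Finset.sum_mul_sq_le_sq_mul_sq Finset.univ α w
  have hgf : ‖g - f‖ ^ 2 ≤ 2 * ‖f‖ ^ 2 + 2 * ‖g‖ ^ 2 := by
    have h1 := parallelogram_law_with_norm ℝ g f
    nlinarith [sq_nonneg ‖g + f‖]
  have ha0 : 0 ≤ α ⬝ᵥ α := Finset.sum_nonneg fun i _ => mul_self_nonneg _
  have hw0 : 0 ≤ w ⬝ᵥ w := Finset.sum_nonneg fun i _ => mul_self_nonneg _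
  -- Cauchy-Schwarz in `H × ℝᵐ` for `(r, σ α)` and `(g - f, σ⁻¹ w)`
  have hcs : (⟪r, g - f⟫ + α ⬝ᵥ w) ^ 2 ≤
      (‖r‖ ^ 2 + σ ^ 2 * α ⬝ᵥ α) * (‖g - f‖ ^ 2 + (σ ^ 2)⁻¹ * w ⬝ᵥ w) := by
    obtain ⟨a, ha⟩ : ∃ a, a = ⟪r, g - f⟫ := ⟨_, rfl⟩
    obtain ⟨b, hb⟩ : ∃ b, b = α ⬝ᵥ w := ⟨_, rfl⟩
    have h2 : b ^ 2 ≤ (σ ^ 2 * α ⬝ᵥ α) * ((σ ^ 2)⁻¹ * w ⬝ᵥ w) := by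
      rw [hb]; refine hcs2.trans_eq ?_; field_simp
    rw [← ha] at hcs1 ⊢
    rw [← hb]
    have hp : 0 ≤ ‖r‖ ^ 2 := by positivity
    have hq : 0 ≤ ‖g - f‖ ^ 2 := by positivity
    have hp' : 0 ≤ σ ^ 2 * α ⬝ᵥ α := by positivity
    have hq' : 0 ≤ (σ ^ 2)⁻¹ * w ⬝ᵥ w := by positivity
    generalize ‖r‖ ^ 2 = p at *
    generalize ‖g - f‖ ^ 2 = q at *
    generalize σ ^ 2 * α ⬝ᵥ α = p' at *
    generalize (σ ^ 2)⁻¹ * w ⬝ᵥ w = q' at *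
    have hab : (a * b) ^ 2 ≤ ((p * q' + p' * q) / 2) ^ 2 := by
      calc (a * b) ^ 2 = a ^ 2 * b ^ 2 := by ring
        _ ≤ (p * q) * (p' * q') := mul_le_mul hcs1 h2 (sq_nonneg _) (by positivity)
        _ ≤ ((p * q' + p' * q) / 2) ^ 2 := by nlinarith [sq_nonneg (p * q' - p' * q)]
    have := abs_le_of_sq_le_sq' hab (by positivity)
    nlinarith [this.2]
  refine hcs.trans (mul_le_mul_of_nonneg_left ?_ (by positivity))
  have : 0 ≤ (σ ^ 2)⁻¹ * w ⬝ᵥ w := by positivity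
  linarith

end Prediction

/-! ### The self-normalized process -/

/-- The normalized exponential `exp (½ eᵀ K (K + 1)⁻¹ e) / √det (K + 1)`, for the kernel matrix `K`
of the points `xs` and the noise values `e = es`. -/
noncomputable def selfNormExp {X : Type*} (k : X → X → ℝ) {m : ℕ} (xs : Fin m → X)
    (es : Fin m → ℝ) : ℝ :=
  Real.exp (explainedEnergy (gram k xs) es / 2) / √(gram k xs + 1).det

section Recursion

variable {X H : Type*} [NormedAddCommGroup H] [InnerProductSpace ℝ H]

/-- One more observation multiplies `selfNormExp` by a factor that depends on the
past only through the posterior mean and variance at the new point. -/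
lemma selfNormExp_succ {k : X → X → ℝ} {Φ : X → H} (hk : ∀ x y, k x y = ⟪Φ x, Φ y⟫)
    {n : ℕ} (xs : Fin (n + 1) → X) (es : Fin (n + 1) → ℝ) (m v : ℝ)
    (hm : m = posteriorMean k 1 (fun j : Fin n => xs (Fin.castSucc j))
      (fun j => es (Fin.castSucc j)) (xs (Fin.last n)))
    (hv : v = posteriorVar k 1 (fun j : Fin n => xs (Fin.castSucc j)) (xs (Fin.last n))) :
    selfNormExp k xs es =
      selfNormExp k (fun j : Fin n => xs (Fin.castSucc j)) (fun j => es (Fin.castSucc j)) *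
        (Real.exp ((es (Fin.last n) ^ 2 - (es (Fin.last n) - m) ^ 2 / (1 + v)) / 2) /
          √(1 + v)) := by
  have hv0 : 0 ≤ v := by rw [hv]; exact posteriorVar_nonneg hk one_pos _ _
  have hone : ∀ {p : ℕ} (zs : Fin p → X), (gram k zs + 1).PosDef := fun zs => by
    simpa using posDef_gram_add_smul_one hk zs one_pos
  set xs0 : Fin n → X := fun j => xs (Fin.castSucc j) with hxs0
  set es0 : Fin n → ℝ := fun j => es (Fin.castSucc j) with hes0
  set A := gram k xs + 1 with hA
  set b : Fin n → ℝ := fun j => k (xs (Fin.last n)) (xs0 j) with hb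
  have hsub : A.submatrix Fin.castSucc Fin.castSucc = gram k xs0 + 1 := by
    ext i j
    simp [hA, gram, Matrix.one_apply, hxs0]
  have hAsymm : A.IsSymm := by
    have := (hone xs).1
    rwa [Matrix.IsHermitian, Matrix.conjTranspose_eq_transpose_of_trivial] at this
  have hrow : (fun j => A (Fin.last n) (Fin.castSucc j)) = b := by
    ext j
    simp [hA, gram, hb, hxs0, (Fin.castSucc_lt_last j).ne']
  have hcol : (fun j => A (Fin.castSucc j) (Fin.last n)) = b := by
    rw [← hrow]; ext j; exact hAsymm.apply _ _
  have hs : A (Fin.last n) (Fin.last n) - b ⬝ᵥ (gram k xs0 + 1)⁻¹ *ᵥ b = 1 + v := by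
    rw [hv, posteriorVar]
    simp only [one_pow, one_smul, ← hb, hA, gram, Matrix.add_apply, Matrix.of_apply,
      Matrix.one_apply_eq]
    ring
  have hmean : b ⬝ᵥ (gram k xs0 + 1)⁻¹ *ᵥ es0 = m := by
    rw [hm, posteriorMean, one_pow, one_smul]
  have hdet : A.det = (gram k xs0 + 1).det * (1 + v) := by
    rw [det_succ_eq_mul_schur A (by rw [hsub]; exact (hone xs0).det_pos.ne'.isUnit), hsub, hrow,
      hcol, hs]
  have hquad := dotProduct_inv_mulVec_succ A hAsymm
    (by rw [hsub]; exact (hone xs0).det_pos.ne'.isUnit) (hone xs).det_pos.ne'.isUnit es es0 b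
    (1 + v) (by positivity) rfl hrow.symm (by rw [hsub, hs])
  rw [hsub, hmean] at hquad
  have hsum : es ⬝ᵥ es = es0 ⬝ᵥ es0 + es (Fin.last n) ^ 2 := by
    simp [dotProduct, Fin.sum_univ_castSucc, hes0, sq]
  rw [selfNormExp, selfNormExp, explainedEnergy, explainedEnergy, ← hA, hquad, hsum, hdet,
    Real.sqrt_mul (hone xs0).det_pos.le, div_mul_div_comm, ← Real.exp_add]
  congr 2
  ring

end Recursion

/-- Mixing the exponential `exp (h e - h² / 2)` over `h ∼ N(m, s²)`. -/
lemma lintegral_exp_mixture (m s e : ℝ) :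
    ∫⁻ z, ENNReal.ofReal (Real.exp ((m + s * z) * e - (m + s * z) ^ 2 / 2)) ∂gaussianReal 0 1 =
      ENNReal.ofReal (Real.exp ((e ^ 2 - (e - m) ^ 2 / (1 + s ^ 2)) / 2) / √(1 + s ^ 2)) := by
  set b := (1 + s ^ 2) / 2 with hb
  set a := s * (e - m) / (1 + s ^ 2) with ha
  set C := Real.exp ((e ^ 2 - (e - m) ^ 2 / (1 + s ^ 2)) / 2) with hC
  have hs : 0 < 1 + s ^ 2 := by positivity
  have hb0 : 0 < b := by positivity
  rw [gaussianReal_of_var_ne_zero _ one_ne_zero,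
    lintegral_withDensity_eq_lintegral_mul _ (measurable_gaussianPDF 0 1) (by fun_prop)]
  have hpt : ∀ z : ℝ, (gaussianPDF 0 1 * fun z =>
      ENNReal.ofReal (Real.exp ((m + s * z) * e - (m + s * z) ^ 2 / 2))) z =
      ENNReal.ofReal ((√(2 * Real.pi))⁻¹ * C) *
        ENNReal.ofReal (Real.exp (-b * (z + -a) ^ 2)) := fun z => by
    have hexp : -(z ^ 2) / 2 + ((m + s * z) * e - (m + s * z) ^ 2 / 2) =
        (e ^ 2 - (e - m) ^ 2 / (1 + s ^ 2)) / 2 + -b * (z + -a) ^ 2 := by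
      rw [hb, ha]; field_simp; ring
    rw [Pi.mul_apply, gaussianPDF, ← ENNReal.ofReal_mul (gaussianPDFReal_nonneg _ _ _),
      ← ENNReal.ofReal_mul (by positivity)]
    congr 1
    simp only [gaussianPDFReal, NNReal.coe_one, mul_one, sub_zero]
    rw [mul_assoc, mul_assoc, ← Real.exp_add, hC, ← Real.exp_add, hexp]
  simp_rw [hpt]
  rw [lintegral_const_mul _ (by fun_prop),
    lintegral_add_right_eq_self (fun z => ENNReal.ofReal (Real.exp (-b * z ^ 2))) (-a),
    ← ofReal_integral_eq_lintegral_ofReal (integrable_exp_neg_mul_sq hb0)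
      (Filter.Eventually.of_forall fun z => (Real.exp_pos _).le),
    integral_gaussian, ← ENNReal.ofReal_mul (by positivity)]
  congr 1
  have h1 : √(Real.pi / b) = √(2 * Real.pi) / √(1 + s ^ 2) := by
    rw [← Real.sqrt_div (by positivity), hb]
    congr 1
    field_simp
  rw [h1]
  have : √(2 * Real.pi) ≠ 0 := by positivity
  field_simp

/-! ### Sub-Gaussian noise -/

section Noise

variable {Ω : Type*} {m mΩ : MeasurableSpace Ω} {μ : Measure Ω}

/-- The random variable `e` is conditionally 1-sub-Gaussian given the σ-algebra `m`, in integrated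
form: `exp (h e - h² / 2)` has conditional expectation at most `1` for every `m`-measurable `h`.
Extended nonnegative weights `W` are used so that no integrability has to be tracked. -/
def IsSubgaussianGiven {Ω : Type*} (m : MeasurableSpace Ω) {mΩ : MeasurableSpace Ω}
    (μ : Measure Ω) (e : Ω → ℝ) : Prop :=
  ∀ (W : Ω → ℝ≥0∞) (h : Ω → ℝ), Measurable[m] W → Measurable[m] h →
    ∫⁻ ω, W ω * ENNReal.ofReal (Real.exp (h ω * e ω - h ω ^ 2 / 2)) ∂μ ≤ ∫⁻ ω, W ω ∂μ

lemma isSubgaussianGiven_of_gaussian [IsProbabilityMeasure μ]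
    (hm : m ≤ mΩ) {σ : ℝ} (hσ : 0 < σ) {ε : Ω → ℝ} (hεm : Measurable ε)
    (hlaw : μ.map ε = gaussianReal 0 (Real.toNNReal (σ ^ 2)))
    (hind : Indep (MeasurableSpace.comap ε inferInstance) m μ) :
    IsSubgaussianGiven m μ fun ω => σ⁻¹ * ε ω := by
  intro W h hW hh
  have hpair : Measurable[m] fun ω => (W ω, h ω) := hW.prodMk hh
  have hIF : IndepFun (fun ω => (W ω, h ω)) ε μ := by
    rw [IndepFun_iff_Indep]
    exact indep_of_indep_of_le_left hind.symm hpair.comap_le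
  have hmap := (indepFun_iff_map_prod_eq_prod_map_map (hpair.mono hm le_rfl).aemeasurable
    hεm.aemeasurable).1 hIF
  have hF : Measurable fun q : (ℝ≥0∞ × ℝ) × ℝ =>
      q.1.1 * ENNReal.ofReal (Real.exp (q.1.2 * (σ⁻¹ * q.2) - q.1.2 ^ 2 / 2)) := by fun_prop
  have hone : ∀ t : ℝ, ∫⁻ z, ENNReal.ofReal (Real.exp (t * (σ⁻¹ * z) - t ^ 2 / 2))
      ∂gaussianReal 0 (Real.toNNReal (σ ^ 2)) = 1 := fun t => by
    have hi : ∀ z : ℝ, Real.exp (t * (σ⁻¹ * z) - t ^ 2 / 2) =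
        Real.exp (-(t ^ 2 / 2)) * Real.exp ((t * σ⁻¹) * z) := fun z => by
      rw [← Real.exp_add]; ring_nf
    simp_rw [hi]
    rw [← ofReal_integral_eq_lintegral_ofReal
      ((integrable_exp_mul_gaussianReal (t * σ⁻¹)).const_mul _)
      (Filter.Eventually.of_forall fun z => by positivity), integral_const_mul]
    have := mgf_gaussianReal (p := gaussianReal 0 (Real.toNNReal (σ ^ 2))) (X := id)
      (μ := 0) (v := Real.toNNReal (σ ^ 2)) (by simp) (t * σ⁻¹)
    simp only [mgf, id] at this
    rw [this, ← Real.exp_add, Real.coe_toNNReal _ (by positivity)]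
    have : -(t ^ 2 / 2) + (0 * (t * σ⁻¹) + σ ^ 2 * (t * σ⁻¹) ^ 2 / 2) = 0 := by
      field_simp; ring
    rw [this, Real.exp_zero, ENNReal.ofReal_one]
  have hpm : Measurable fun ω => ((W ω, h ω), ε ω) := (hpair.mono hm le_rfl).prodMk hεm
  calc ∫⁻ ω, W ω * ENNReal.ofReal (Real.exp (h ω * (σ⁻¹ * ε ω) - h ω ^ 2 / 2)) ∂μ
      = ∫⁻ q : (ℝ≥0∞ × ℝ) × ℝ,
          q.1.1 * ENNReal.ofReal (Real.exp (q.1.2 * (σ⁻¹ * q.2) - q.1.2 ^ 2 / 2))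
          ∂μ.map (fun ω => ((W ω, h ω), ε ω)) := (lintegral_map hF hpm).symm
    _ = ∫⁻ p : ℝ≥0∞ × ℝ, p.1 ∂μ.map (fun ω => (W ω, h ω)) := by
        rw [hmap, lintegral_prod _ hF.aemeasurable]
        refine lintegral_congr fun p => ?_
        dsimp only
        rw [lintegral_const_mul _ (by fun_prop), hlaw, hone, mul_one]
    _ = ∫⁻ ω, W ω ∂μ := lintegral_map measurable_fst (hpair.mono hm le_rfl)
    _ ≤ ∫⁻ ω, W ω ∂μ := le_rfl

/-- Hoeffding's bound by the chord of `exp` over `[-|h|, |h|]`. -/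
lemma exp_mul_le_cosh_add_mul_sinh (h : ℝ) {e : ℝ} (he : |e| ≤ 1) :
    Real.exp (h * e) ≤ Real.cosh h + e * Real.sinh h := by
  obtain ⟨h1, h2⟩ := abs_le.1 he
  have hconv := convexOn_exp
  have := hconv.2 (Set.mem_univ h) (Set.mem_univ (-h)) (by linarith : 0 ≤ (1 + e) / 2)
    (by linarith : 0 ≤ (1 - e) / 2) (by ring)
  simp only [smul_eq_mul] at this
  rw [Real.cosh_eq, Real.sinh_eq]
  have h3 : (1 + e) / 2 * h + (1 - e) / 2 * -h = h * e := by ring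
  rw [h3] at this
  linarith

lemma isSubgaussianGiven_of_bounded [IsProbabilityMeasure μ]
    (hm : m ≤ mΩ) {σ : ℝ} (hσ : 0 < σ) {ε : Ω → ℝ} (hεm : Measurable ε)
    (hbd : ∀ᵐ ω ∂μ, |ε ω| ≤ σ) (hce : μ[ε | m] =ᵐ[μ] 0) :
    IsSubgaussianGiven m μ fun ω => σ⁻¹ * ε ω := by
  intro W h hW hh
  have hεi : Integrable ε μ := Integrable.of_bound hεm.aestronglyMeasurable σ hbd
  have hh' : Measurable h := hh.mono hm le_rfl
  set g : Ω → ℝ≥0∞ := fun ω => ENNReal.ofReal (Real.exp (h ω * (σ⁻¹ * ε ω) - h ω ^ 2 / 2)) with hg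
  have hgm : Measurable g := by fun_prop
  -- the measure with density `exp (h e - h² / 2)` is dominated by `μ` on the sets of `m`
  have hset : ∀ A, MeasurableSet[m] A → ∫⁻ ω in A, g ω ∂μ ≤ μ A := by
    intro A hA
    have hA' : MeasurableSet A := hm A hA
    set B : Ω → ℝ := fun ω => Real.exp (-(h ω ^ 2 / 2)) * Real.sinh (h ω) * σ⁻¹ with hB
    have hBm : Measurable[m] B := by
      refine (Measurable.mul ?_ ?_).mul_const _
      · exact Real.measurable_exp.comp ((hh.pow_const 2).div_const 2).neg
      · exact Real.measurable_sinh.comp hh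
    have hcosh : ∀ t : ℝ, Real.exp (-(t ^ 2 / 2)) * Real.cosh t ≤ 1 := fun t => by
      calc _ ≤ Real.exp (-(t ^ 2 / 2)) * Real.exp (t ^ 2 / 2) := by
            gcongr; exact Real.cosh_le_exp_half_sq t
        _ = 1 := by rw [← Real.exp_add]; simp
    have hBb : ∀ ω, ‖B ω‖ ≤ σ⁻¹ := fun ω => by
      have hsinh : |Real.sinh (h ω)| ≤ Real.cosh (h ω) := by
        rw [Real.sinh_eq, Real.cosh_eq, abs_le]
        have := Real.exp_pos (h ω)
        have := Real.exp_pos (-h ω)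
        constructor <;> linarith
      rw [hB, Real.norm_eq_abs, abs_mul, abs_mul, Real.abs_exp, abs_of_pos (inv_pos.2 hσ)]
      refine mul_le_of_le_one_left (inv_pos.2 hσ).le ((mul_le_mul_of_nonneg_left hsinh
        (Real.exp_pos _).le).trans (hcosh _))
    have hBε : Integrable (fun ω => B ω * ε ω) μ :=
      hεi.bdd_mul (hBm.mono hm le_rfl).aestronglyMeasurable (Filter.Eventually.of_forall hBb)
    have hzero : ∫ ω in A, B ω * ε ω ∂μ = 0 := by
      rw [← setIntegral_condExp hm hBε hA]
      have h1 : μ[fun ω => B ω * ε ω | m] =ᵐ[μ] B * μ[ε | m] :=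
        condExp_mul_of_stronglyMeasurable_left hBm.stronglyMeasurable hBε hεi
      have h2 : μ[fun ω => B ω * ε ω | m] =ᵐ[μ] 0 := by
        filter_upwards [h1, hce] with ω h1 h2
        rw [h1, Pi.mul_apply, h2]; simp
      rw [setIntegral_congr_ae (g := fun _ => (0 : ℝ)) hA' (h2.mono fun ω hω _ => hω)]
      simp
    have hae : ∀ᵐ ω ∂μ.restrict A, Real.exp (h ω * (σ⁻¹ * ε ω) - h ω ^ 2 / 2) ≤
        1 + B ω * ε ω := by
      refine ae_restrict_of_ae (hbd.mono fun ω hω => ?_)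
      have h1 : |σ⁻¹ * ε ω| ≤ 1 := by
        rw [abs_mul, abs_of_pos (inv_pos.2 hσ), inv_mul_le_iff₀ hσ, mul_one]
        exact hω
      calc Real.exp (h ω * (σ⁻¹ * ε ω) - h ω ^ 2 / 2)
          = Real.exp (-(h ω ^ 2 / 2)) * Real.exp (h ω * (σ⁻¹ * ε ω)) := by
            rw [← Real.exp_add]; ring_nf
        _ ≤ Real.exp (-(h ω ^ 2 / 2)) *
            (Real.cosh (h ω) + σ⁻¹ * ε ω * Real.sinh (h ω)) := by
            gcongr; exact exp_mul_le_cosh_add_mul_sinh _ h1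
        _ = Real.exp (-(h ω ^ 2 / 2)) * Real.cosh (h ω) + B ω * ε ω := by rw [hB]; ring
        _ ≤ 1 + B ω * ε ω := by gcongr; exact hcosh _
    calc ∫⁻ ω in A, g ω ∂μ ≤ ∫⁻ ω in A, ENNReal.ofReal (1 + B ω * ε ω) ∂μ :=
          lintegral_mono_ae (hae.mono fun ω hω => ENNReal.ofReal_le_ofReal hω)
      _ = ENNReal.ofReal (∫ ω in A, (1 + B ω * ε ω) ∂μ) := by
          have hi : Integrable (fun ω => 1 + B ω * ε ω) (μ.restrict A) :=
            (integrable_const 1).add hBε.integrableOn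
          rw [ofReal_integral_eq_lintegral_ofReal hi]
          exact hae.mono fun ω hω => (Real.exp_pos _).le.trans hω
      _ = μ A := by
          rw [integral_add (integrable_const _) hBε.integrableOn, hzero]
          simp [Measure.real]
  calc ∫⁻ ω, W ω * g ω ∂μ = ∫⁻ ω, W ω ∂μ.withDensity g := by
        rw [lintegral_withDensity_eq_lintegral_mul _ hgm (hW.mono hm le_rfl)]
        exact lintegral_congr fun ω => mul_comm _ _
    _ = ∫⁻ ω, W ω ∂(μ.withDensity g).trim hm := (lintegral_trim hm hW).symm
    _ ≤ ∫⁻ ω, W ω ∂μ.trim hm := by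
        refine lintegral_mono' (Measure.le_iff.2 fun A hA => ?_) le_rfl
        rw [trim_measurableSet_eq hm hA, trim_measurableSet_eq hm hA,
          withDensity_apply _ (hm A hA)]
        exact hset A hA
    _ = ∫⁻ ω, W ω ∂μ := lintegral_trim hm hW

end Noise

/-! ### Measurability of the posterior -/

section Measurability

variable {Ω X : Type*} [MeasurableSpace Ω] [MeasurableSpace X]

lemma measurable_det {m : ℕ} {A : Ω → Matrix (Fin m) (Fin m) ℝ}
    (hA : ∀ i j, Measurable fun ω => A ω i j) : Measurable fun ω => (A ω).det := by
  simp only [Matrix.det_apply]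
  exact Finset.measurable_fun_sum _ fun p _ =>
    (Finset.measurable_fun_prod _ fun i _ => hA _ _).const_smul _

lemma measurable_inv_apply {m : ℕ} {A : Ω → Matrix (Fin m) (Fin m) ℝ}
    (hA : ∀ i j, Measurable fun ω => A ω i j) (i j : Fin m) :
    Measurable fun ω => (A ω)⁻¹ i j := by
  simp only [Matrix.inv_def, Matrix.smul_apply, Ring.inverse_eq_inv', smul_eq_mul,
    Matrix.adjugate_apply]
  refine (measurable_det hA).inv.mul (measurable_det fun a b => ?_)
  simp only [Matrix.updateRow_apply]
  split_ifs
  · exact measurable_const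
  · exact hA a b

lemma measurable_dotProduct_inv_mulVec {m : ℕ} {A : Ω → Matrix (Fin m) (Fin m) ℝ}
    {u w : Ω → Fin m → ℝ} (hA : ∀ i j, Measurable fun ω => A ω i j)
    (hu : ∀ i, Measurable fun ω => u ω i) (hw : ∀ i, Measurable fun ω => w ω i) :
    Measurable fun ω => u ω ⬝ᵥ (A ω)⁻¹ *ᵥ w ω := by
  simp only [dotProduct, Matrix.mulVec]
  exact Finset.measurable_fun_sum _ fun i _ => (hu i).mul
    (Finset.measurable_fun_sum _ fun j _ => (measurable_inv_apply hA i j).mul (hw j))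

lemma measurable_gram_add_apply {k : X → X → ℝ} (hk : Measurable fun p : X × X => k p.1 p.2)
    {m : ℕ} (r : ℝ) {xs : Ω → Fin m → X} (hxs : ∀ j, Measurable fun ω => xs ω j) (i j : Fin m) :
    Measurable fun ω => (gram k (xs ω) + r • (1 : Matrix (Fin m) (Fin m) ℝ)) i j := by
  simp only [Matrix.add_apply, gram, Matrix.of_apply]
  exact (hk.comp ((hxs i).prodMk (hxs j))).add_const _

lemma measurable_posteriorMean {k : X → X → ℝ} (hk : Measurable fun p : X × X => k p.1 p.2)
    {m : ℕ} (σ : ℝ) {xs : Ω → Fin m → X} {es : Ω → Fin m → ℝ} {x : Ω → X}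
    (hxs : ∀ j, Measurable fun ω => xs ω j) (hes : ∀ j, Measurable fun ω => es ω j)
    (hx : Measurable x) : Measurable fun ω => posteriorMean k σ (xs ω) (es ω) (x ω) :=
  measurable_dotProduct_inv_mulVec (measurable_gram_add_apply hk _ hxs)
    (fun i => hk.comp (hx.prodMk (hxs i))) hes

lemma measurable_posteriorVar {k : X → X → ℝ} (hk : Measurable fun p : X × X => k p.1 p.2)
    {m : ℕ} (σ : ℝ) {xs : Ω → Fin m → X} {x : Ω → X}
    (hxs : ∀ j, Measurable fun ω => xs ω j) (hx : Measurable x) :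
    Measurable fun ω => posteriorVar k σ (xs ω) (x ω) :=
  (hk.comp (hx.prodMk hx)).sub (measurable_dotProduct_inv_mulVec
    (measurable_gram_add_apply hk _ hxs) (fun i => hk.comp (hx.prodMk (hxs i)))
    fun i => hk.comp (hx.prodMk (hxs i)))

lemma measurable_selfNormExp {k : X → X → ℝ} (hk : Measurable fun p : X × X => k p.1 p.2)
    {m : ℕ} {xs : Ω → Fin m → X} {es : Ω → Fin m → ℝ}
    (hxs : ∀ j, Measurable fun ω => xs ω j) (hes : ∀ j, Measurable fun ω => es ω j) :
    Measurable fun ω => selfNormExp k (xs ω) (es ω) := by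
  have hg : ∀ i j, Measurable fun ω => (gram k (xs ω) + 1) i j := by
    simpa using measurable_gram_add_apply hk 1 hxs
  refine Measurable.div (Real.measurable_exp.comp (Measurable.div_const (Measurable.sub ?_ ?_) 2))
    (measurable_det hg).sqrt
  · simp only [dotProduct]
    exact Finset.measurable_fun_sum _ fun i _ => (hes i).mul (hes i)
  · exact measurable_dotProduct_inv_mulVec hg hes hes

end Measurability

/-! ### The self-normalized deviation bound -/

section Supermartingale

variable {Ω X H : Type*} [mΩ : MeasurableSpace Ω] [MeasurableSpace X]
  [NormedAddCommGroup H] [InnerProductSpace ℝ H] {μ : Measure Ω}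

/-- `selfNormExp` along the samples is a supermartingale started at `1`: its growth factor is the
Gaussian mixture of exponentials `exp (h e - h² / 2)` with predictable `h`. -/
lemma lintegral_selfNormExp_le_one [IsProbabilityMeasure μ] {k : X → X → ℝ} {Φ : X → H}
    (hk : ∀ x y, k x y = ⟪Φ x, Φ y⟫) (hkm : Measurable fun p : X × X => k p.1 p.2)
    {ℱ : Filtration ℕ mΩ} {N : ℕ} {x : ℕ → Ω → X} {e : ℕ → Ω → ℝ}
    (hx : ∀ i < N, Measurable[ℱ i] (x (i + 1))) (he : ∀ i < N, Measurable[ℱ (i + 1)] (e (i + 1)))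
    (hsub : ∀ i < N, IsSubgaussianGiven (ℱ i) μ (e (i + 1))) :
    ∀ n ≤ N, ∫⁻ ω, ENNReal.ofReal (selfNormExp k (firstTerms (fun j => x j ω) n)
      (firstTerms (fun j => e j ω) n)) ∂μ ≤ 1 := by
  intro n
  induction n with
  | zero => intro _; simp [selfNormExp, explainedEnergy]
  | succ n ih =>
    intro hn
    have hnN : n < N := hn
    set xs : Ω → Fin n → X := fun ω => firstTerms (fun j => x j ω) n with hxs
    set es : Ω → Fin n → ℝ := fun ω => firstTerms (fun j => e j ω) n with hes
    set M : Ω → ℝ := fun ω => selfNormExp k (xs ω) (es ω) with hM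
    set m : Ω → ℝ := fun ω => posteriorMean k 1 (xs ω) (es ω) (x (n + 1) ω) with hm
    set s : Ω → ℝ := fun ω => √(posteriorVar k 1 (xs ω) (x (n + 1) ω)) with hs
    have hxsm : ∀ j, Measurable[ℱ n] fun ω => xs ω j := fun j =>
      (hx j.val (j.2.trans hnN)).mono (ℱ.mono j.2.le) le_rfl
    have hesm : ∀ j, Measurable[ℱ n] fun ω => es ω j := fun j =>
      (he j.val (j.2.trans hnN)).mono (ℱ.mono j.2) le_rfl
    have hMm : Measurable[ℱ n] M := @measurable_selfNormExp Ω X (ℱ n) _ k hkm n xs es hxsm hesm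
    have hmm : Measurable[ℱ n] m :=
      @measurable_posteriorMean Ω X (ℱ n) _ k hkm n 1 xs es _ hxsm hesm (hx n hnN)
    have hsm : Measurable[ℱ n] s :=
      (@measurable_posteriorVar Ω X (ℱ n) _ k hkm n 1 xs _ hxsm (hx n hnN)).sqrt
    have hM0 : ∀ ω, 0 ≤ M ω := fun ω => by
      simp only [hM, selfNormExp]; positivity
    have hstep : ∀ ω, ENNReal.ofReal (selfNormExp k (firstTerms (fun j => x j ω) (n + 1))
        (firstTerms (fun j => e j ω) (n + 1))) = ∫⁻ z, ENNReal.ofReal (M ω) * ENNReal.ofReal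
          (Real.exp ((m ω + s ω * z) * e (n + 1) ω - (m ω + s ω * z) ^ 2 / 2))
          ∂gaussianReal 0 1 := fun ω => by
      have hv := posteriorVar_nonneg hk one_pos (xs ω) (x (n + 1) ω)
      rw [lintegral_const_mul _ (by fun_prop), lintegral_exp_mixture,
        ← ENNReal.ofReal_mul (hM0 ω), hs, Real.sq_sqrt hv]
      congr 1
      exact selfNormExp_succ hk (firstTerms (fun j => x j ω) (n + 1))
        (firstTerms (fun j => e j ω) (n + 1)) (m ω) (posteriorVar k 1 (xs ω) (x (n + 1) ω))
        rfl rfl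
    have hMm' : Measurable M := hMm.mono (ℱ.le n) le_rfl
    have hmm' : Measurable m := hmm.mono (ℱ.le n) le_rfl
    have hsm' : Measurable s := hsm.mono (ℱ.le n) le_rfl
    have hem' : Measurable (e (n + 1)) := (he n hnN).mono (ℱ.le _) le_rfl
    simp_rw [hstep]
    rw [lintegral_lintegral_swap (by
      refine Measurable.aemeasurable ?_
      simp only [Function.uncurry_def]
      fun_prop)]
    calc _ ≤ ∫⁻ _ : ℝ, ∫⁻ ω, ENNReal.ofReal (M ω) ∂μ ∂gaussianReal 0 1 := by
          refine lintegral_mono fun z => hsub n hnN _ _ ?_ ?_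
          · exact ENNReal.measurable_ofReal.comp hMm
          · exact hmm.add (hsm.mul_const z)
      _ = ∫⁻ ω, ENNReal.ofReal (M ω) ∂μ := by simp
      _ ≤ 1 := ih hnN.le

/-- Self-normalized deviation bound, from Markov's inequality for the supermartingale. -/
lemma measure_explainedEnergy_gt_le [IsProbabilityMeasure μ] {k : X → X → ℝ} {Φ : X → H}
    (hk : ∀ x y, k x y = ⟪Φ x, Φ y⟫) (hkm : Measurable fun p : X × X => k p.1 p.2)
    {ℱ : Filtration ℕ mΩ} {N : ℕ} {x : ℕ → Ω → X} {e : ℕ → Ω → ℝ}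
    (hx : ∀ i < N, Measurable[ℱ i] (x (i + 1))) (he : ∀ i < N, Measurable[ℱ (i + 1)] (e (i + 1)))
    (hsub : ∀ i < N, IsSubgaussianGiven (ℱ i) μ (e (i + 1))) {δ : ℝ} (hδ : 0 < δ) :
    μ {ω | Real.log (gram k (firstTerms (fun j => x j ω) N) + 1).det + 2 * Real.log (1 / δ) <
      explainedEnergy (gram k (firstTerms (fun j => x j ω) N)) (firstTerms (fun j => e j ω) N)} ≤
      ENNReal.ofReal δ := by
  set M : Ω → ℝ := fun ω => selfNormExp k (firstTerms (fun j => x j ω) N)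
    (firstTerms (fun j => e j ω) N) with hM
  have hMm : Measurable M := measurable_selfNormExp hkm
    (fun j => (hx j.val j.2).mono (ℱ.le _) le_rfl) (fun j => (he j.val j.2).mono (ℱ.le _) le_rfl)
  have hmarkov := mul_meas_ge_le_lintegral (μ := μ) (hMm.ennreal_ofReal) (ENNReal.ofReal (1 / δ))
  have hint := lintegral_selfNormExp_le_one hk hkm hx he hsub N le_rfl
  refine (measure_mono (t := {ω | ENNReal.ofReal (1 / δ) ≤ ENNReal.ofReal (M ω)}) ?_).trans ?_
  · intro ω hω
    have hω : Real.log (gram k (firstTerms (fun j => x j ω) N) + 1).det + 2 * Real.log (1 / δ) <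
      explainedEnergy (gram k (firstTerms (fun j => x j ω) N))
        (firstTerms (fun j => e j ω) N) := hω
    refine ENNReal.ofReal_le_ofReal ?_
    have hdet : 0 < (gram k (firstTerms (fun j => x j ω) N) + 1).det := by
      simpa using (posDef_gram_add_smul_one hk (firstTerms (fun j => x j ω) N) one_pos).det_pos
    simp only [hM, selfNormExp]
    rw [le_div_iff₀ (Real.sqrt_pos.2 hdet), ← Real.log_le_iff_le_exp (by positivity),
      Real.log_mul (by positivity) (by positivity), Real.log_sqrt hdet.le]
    linarith
  · have h1 : ENNReal.ofReal (1 / δ) * μ {ω | ENNReal.ofReal (1 / δ) ≤ ENNReal.ofReal (M ω)} ≤ 1 :=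
      hmarkov.trans hint
    calc _ = ENNReal.ofReal δ * (ENNReal.ofReal (1 / δ) *
          μ {ω | ENNReal.ofReal (1 / δ) ≤ ENNReal.ofReal (M ω)}) := by
          rw [← mul_assoc, ← ENNReal.ofReal_mul hδ.le, mul_one_div_cancel hδ.ne',
            ENNReal.ofReal_one, one_mul]
      _ ≤ ENNReal.ofReal δ * 1 := by gcongr
      _ = ENNReal.ofReal δ := mul_one _

end Supermartingale

/-! ### Information gain and learning bound -/

section InfoGain

variable {X : Type*} [TopologicalSpace X]

lemma bddAbove_infoGain [CompactSpace X] {k : X → X → ℝ}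
    (hk : Continuous fun p : X × X => k p.1 p.2) (σ : ℝ)
    (hpos : ∀ m (xs : Fin m → X), 0 < (1 + (σ ^ 2)⁻¹ • gram k xs : Matrix (Fin m) (Fin m) ℝ).det)
    (m : ℕ) : BddAbove (Set.range fun xs : Fin m → X =>
      (1 / 2 : ℝ) * Real.log (1 + (σ ^ 2)⁻¹ • gram k xs : Matrix (Fin m) (Fin m) ℝ).det) := by
  refine (isCompact_range ?_).bddAbove
  have hg : Continuous fun xs : Fin m → X =>
      (1 + (σ ^ 2)⁻¹ • gram k xs : Matrix (Fin m) (Fin m) ℝ) := by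
    have hgram : Continuous fun xs : Fin m → X => gram k xs := by
      refine continuous_matrix fun i j => ?_
      simp only [gram, Matrix.of_apply]
      exact hk.comp (f := fun xs : Fin m → X => (xs i, xs j))
        ((continuous_apply i).prodMk (continuous_apply j))
    fun_prop
  exact continuous_const.mul (hg.matrix_det.log fun xs => (hpos m xs).ne')

lemma continuous_posteriorStd {k : X → X → ℝ} (hk : Continuous fun p : X × X => k p.1 p.2) (σ : ℝ)
    {m : ℕ} (xs : Fin m → X) : Continuous fun p => posteriorStd k σ xs p := by
  have hv : ∀ a, Continuous fun p => k p (xs a) := fun a =>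
    hk.comp (continuous_id.prodMk continuous_const)
  refine Continuous.sqrt ((hk.comp (continuous_id.prodMk continuous_id)).sub ?_)
  simp only [dotProduct, Matrix.mulVec]
  fun_prop

/-- The maximum defining the learning bound is attained. -/
lemma isGreatest_learningBound [CompactSpace X] [Nonempty X] {k : X → X → ℝ}
    (hk : Continuous fun p : X × X => k p.1 p.2) (σ β : ℝ) (x : ℕ → X) (N : ℕ) :
    IsGreatest (Set.range fun p : X => √β * stdAfter k σ x N p) (learningBound k σ β x N) := by
  have hcont : Continuous fun p : X => √β * stdAfter k σ x N p :=
    continuous_const.mul (continuous_posteriorStd hk σ _)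
  have hcomp := isCompact_range hcont
  exact ⟨hcomp.sSup_mem (Set.range_nonempty _), fun _ hy => le_csSup hcomp.bddAbove hy⟩

end InfoGain

/-! ### The confidence bound -/

/-- The deviation term is absorbed by the constant in `betaSucc`; here `N ≥ 2 δ` enters, through
`log (N / δ) ≥ log 2`. -/
lemma two_mul_energy_le_betaSucc {γ δ Q fnorm : ℝ} (hγ : 0 ≤ γ) (hδ0 : 0 < δ) (hδ1 : δ < 1) {N : ℕ}
    (hN : 2 * δ ≤ N) (hQ : Q ≤ 6 * (2 * γ) * (1 + Real.log (1 / δ))) :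
    2 * fnorm ^ 2 + 2 * Q ≤ betaSucc fnorm γ δ N := by
  have hN1 : (1 : ℝ) ≤ N := by
    have : (0 : ℝ) < N := by linarith
    exact_mod_cast Nat.one_le_iff_ne_zero.2 (by rintro rfl; simp at this)
  set L := Real.log ((N : ℝ) / δ) with hL
  have h1 : Real.log (1 / δ) ≤ L := Real.log_le_log (by positivity) (by gcongr)
  have h2 : 0.6931 < L := by
    have : Real.log 2 ≤ L := Real.log_le_log two_pos (by rw [le_div_iff₀ hδ0]; exact hN)
    linarith [Real.log_two_gt_d9]
  have h3 : 24 * (1 + L) ≤ 300 * L ^ 3 := by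
    have : 0.48 ≤ L ^ 2 := by nlinarith
    nlinarith [mul_le_mul_of_nonneg_right this (by linarith : 0 ≤ L)]
  rw [betaSucc]
  have h4 : γ * (24 * (1 + Real.log (1 / δ))) ≤ γ * (300 * L ^ 3) :=
    mul_le_mul_of_nonneg_left (by linarith) hγ
  linarith

/-- The confidence bound for Gaussian process regression on a compact space, at an adaptively chosen
sequence of points and with conditionally sub-Gaussian noise. -/
lemma measure_confidence_ge {X H Ω : Type*} [TopologicalSpace X] [CompactSpace X]
    [SecondCountableTopology X] [MeasurableSpace X] [BorelSpace X]
    [NormedAddCommGroup H] [InnerProductSpace ℝ H]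
    {k : X → X → ℝ} (hkc : Continuous fun p : X × X => k p.1 p.2)
    {Φ : X → H} (hk : ∀ x y, k x y = ⟪Φ x, Φ y⟫) {V : X → ℝ} (f : H) (hV : ∀ x, V x = ⟪f, Φ x⟫)
    {δ : ℝ} (hδ0 : 0 < δ) (hδ1 : δ < 1) {N : ℕ} (hN : 2 * δ ≤ N) {σ : ℝ} (hσ : 0 < σ)
    [mΩ : MeasurableSpace Ω] {μ : Measure Ω} [IsProbabilityMeasure μ] {ℱ : Filtration ℕ mΩ}
    {x : ℕ → Ω → X} {y ε : ℕ → Ω → ℝ}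
    (hx : ∀ i < N, Measurable[ℱ i] (x (i + 1))) (hε : ∀ i < N, Measurable[ℱ (i + 1)] (ε (i + 1)))
    (hy : ∀ i < N, ∀ ω, y (i + 1) ω = V (x (i + 1) ω) + ε (i + 1) ω)
    (hsub : ∀ i < N, IsSubgaussianGiven (ℱ i) μ fun ω => σ⁻¹ * ε (i + 1) ω) :
    ENNReal.ofReal (1 - δ) ≤ μ {ω | ∀ p,
      |meanAfter k σ (fun i => x i ω) (fun i => y i ω) N p - V p| ≤
        √(betaSucc ‖f‖ (maxInfoGain k σ N) δ N) * stdAfter k σ (fun i => x i ω) N p} := by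
  set γ := maxInfoGain k σ N with hγ
  set c := mixtureScale (2 * γ) with hc
  have hc0 : 0 < c := mixtureScale_pos _
  have hσ2 : 0 < σ ^ 2 := by positivity
  -- the rescaled kernel of the mixture
  set a : ℝ := c * (σ ^ 2)⁻¹ with ha
  have ha0 : 0 < a := by positivity
  set k' : X → X → ℝ := fun p q => a * k p q with hk'
  have hk'Φ : ∀ p q, k' p q = ⟪√a • Φ p, √a • Φ q⟫ := fun p q => by
    rw [inner_smul_left, inner_smul_right, ← hk, RCLike.conj_to_real, ← mul_assoc,
      Real.mul_self_sqrt ha0.le]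
  have hk'm : Measurable fun p : X × X => k' p.1 p.2 :=
    (continuous_const.mul hkc).measurable
  have hgram : ∀ {m : ℕ} (xs : Fin m → X), gram k' xs = c • ((σ ^ 2)⁻¹ • gram k xs) := fun xs => by
    ext i j
    simp [gram, hk', ha, mul_assoc]
  have hpsd : ∀ {m : ℕ} (xs : Fin m → X), ((σ ^ 2)⁻¹ • gram k xs).PosSemidef := fun xs =>
    (posSemidef_gram_of_inner hk xs).smul (inv_pos.2 hσ2).le
  have hone : ∀ {m : ℕ} (xs : Fin m → X),
      1 ≤ (1 + (σ ^ 2)⁻¹ • gram k xs : Matrix (Fin m) (Fin m) ℝ).det := fun xs => by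
    obtain ⟨lam, z, hlam, h⟩ := exists_spectral_explainedEnergy (hpsd xs) 0
    have := (h 1 zero_le_one).1
    simp only [one_smul, one_mul] at this
    rw [add_comm, this]
    have hsum : 0 ≤ ∑ i, lam i := Finset.sum_nonneg fun i _ => hlam i
    linarith [one_add_sum_le_prod_one_add Finset.univ lam hlam]
  have hbdd := bddAbove_infoGain hkc σ (fun m xs => one_pos.trans_le (hone xs)) N
  have hdet : ∀ xs : Fin N → X,
      (1 + (σ ^ 2)⁻¹ • gram k xs : Matrix (Fin N) (Fin N) ℝ).det ≤ Real.exp (2 * γ) := fun xs => by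
    rw [← Real.log_le_iff_le_exp (one_pos.trans_le (hone xs))]
    have := le_ciSup hbdd xs
    rw [hγ, maxInfoGain]
    linarith
  have hγ0 : 0 ≤ γ :=
    Real.iSup_nonneg fun xs => mul_nonneg (by norm_num) (Real.log_nonneg (hone xs))
  set bad : Set Ω := {ω | Real.log (gram k' (firstTerms (fun j => x j ω) N) + 1).det +
    2 * Real.log (1 / δ) < explainedEnergy (gram k' (firstTerms (fun j => x j ω) N))
      (firstTerms (fun j => σ⁻¹ * ε j ω) N)} with hbad
  have hbadle : μ bad ≤ ENNReal.ofReal δ :=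
    measure_explainedEnergy_gt_le (e := fun i ω => σ⁻¹ * ε i ω) hk'Φ hk'm hx
      (fun i hi => (hε i hi).const_mul _) hsub hδ0
  set good : Set Ω := {ω | ∀ p, |meanAfter k σ (fun i => x i ω) (fun i => y i ω) N p - V p| ≤
    √(betaSucc ‖f‖ γ δ N) * stdAfter k σ (fun i => x i ω) N p} with hgood
  have hcover : ∀ ω, ω ∉ bad → ω ∈ good := by
    intro ω hω p
    set xs := firstTerms (fun j => x j ω) N with hxs
    set es := firstTerms (fun j => ε j ω) N with hes
    have hes' : firstTerms (fun j => σ⁻¹ * ε j ω) N = σ⁻¹ • es := rfl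
    have hω : explainedEnergy (gram k' xs) (σ⁻¹ • es) ≤
        Real.log (gram k' xs + 1).det + 2 * Real.log (1 / δ) := not_lt.1 hω
    obtain ⟨lam, z, hlam, h⟩ := exists_spectral_explainedEnergy (hpsd xs) (σ⁻¹ • es)
    have h1 := h 1 zero_le_one
    simp only [one_smul, one_mul] at h1
    rw [hgram, (h c hc0.le).1, (h c hc0.le).2] at hω
    have hQ : explainedEnergy ((σ ^ 2)⁻¹ • gram k xs) (σ⁻¹ • es) ≤
        6 * (2 * γ) * (1 + Real.log (1 / δ)) := by
      rw [h1.2]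
      refine sum_le_of_mixtureScale lam z hlam (by positivity)
        (Real.log_nonneg (by rw [le_div_iff₀ hδ0]; linarith)) ?_ hω
      rw [← h1.1, add_comm]
      exact hdet xs
    have hβ := two_mul_energy_le_betaSucc (fnorm := ‖f‖) hγ0 hδ0 hδ1 hN hQ
    have herr := prediction_error_sq_le hk f hV hσ xs (firstTerms (fun j => y j ω) N) es
      (fun j => hy j.val j.2 ω) p
    have hvar := posteriorVar_nonneg hk hσ xs p
    change |posteriorMean k σ xs (firstTerms (fun j => y j ω) N) p - V p| ≤
      √(betaSucc ‖f‖ γ δ N) * √(posteriorVar k σ xs p)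
    rw [mul_comm, ← Real.sqrt_mul hvar]
    exact Real.abs_le_sqrt (herr.trans (mul_le_mul_of_nonneg_left hβ hvar))
  have huniv : (1 : ℝ≥0∞) ≤ μ good + ENNReal.ofReal δ := by
    calc (1 : ℝ≥0∞) = μ Set.univ := measure_univ.symm
      _ ≤ μ (good ∪ bad) := measure_mono fun ω _ => by
          by_cases hω : ω ∈ bad
          · exact Or.inr hω
          · exact Or.inl (hcover ω hω)
      _ ≤ μ good + μ bad := measure_union_le _ _
      _ ≤ μ good + ENNReal.ofReal δ := by gcongr
  rw [ENNReal.ofReal_sub _ hδ0.le, ENNReal.ofReal_one]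
  exact tsub_le_iff_right.2 huniv

end NPPLF

theorem theorem1
    -- the network, the uncertain injections and the inverse power flow voltage magnitude
    {n : ℕ} (G B : Matrix (Fin n) (Fin n) ℝ)
    {ι : Type*} [Fintype ι] (bus : ι ↪ Fin n) (𝒮 : Set (Fin n → ℂ))
    (Pmin Pmax : ι → ℝ) (hbox : Pmin ≤ Pmax)
    (hproj : NPPLF.realInjection bus '' 𝒮 = Set.Icc Pmin Pmax)
    (l : Fin n) (V : Set.Icc Pmin Pmax → ℝ)
    (hV : NPPLF.IsInverseVoltageMagnitude G B bus 𝒮 l V)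
    -- the continuous kernel `k`, its reproducing kernel Hilbert space `H`, and `V ∈ H`
    (k : Set.Icc Pmin Pmax → Set.Icc Pmin Pmax → ℝ)
    (hk_cont : Continuous fun p : Set.Icc Pmin Pmax × Set.Icc Pmin Pmax => k p.1 p.2)
    {H : Type*} [NormedAddCommGroup H] [InnerProductSpace ℝ H] [CompleteSpace H]
    [RKHS ℝ H (Set.Icc Pmin Pmax) ℝ]
    (hk : ∀ P Q : Set.Icc Pmin Pmax, RKHS.kernel H P Q (1 : ℝ) = k P Q)
    (f : H) (hf : ∀ P : Set.Icc Pmin Pmax, f P = V P)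
    -- the confidence level, the number of samples and the noise level
    (δ : ℝ) (hδ0 : 0 < δ) (hδ1 : δ < 1) (N : ℕ) (hN : 2 * δ ≤ (N : ℝ)) (σ : ℝ) (hσ : 0 < σ)
    -- the noise and the GP-UCB run
    {Ω : Type*} [mΩ : MeasurableSpace Ω] (μ : Measure Ω) [IsProbabilityMeasure μ]
    (ℱ : Filtration ℕ mΩ) (x : ℕ → Ω → Set.Icc Pmin Pmax) (y ε : ℕ → Ω → ℝ)
    (hε : NPPLF.IsGaussianNoise μ ℱ σ N ε ∨ NPPLF.IsBoundedNoise μ ℱ σ N ε)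
    (β : ℕ → ℝ) (hβ : ∀ i, 1 ≤ i → β (i + 1) = NPPLF.betaSucc ‖f‖ (NPPLF.maxInfoGain k σ N) δ i)
    (hrun : NPPLF.IsGPUCBRun k σ (fun i => β (i + 1)) V ℱ N x y ε)
    (ξmax : Ω → ℝ)
    (hξ : ∀ ω, ξmax ω = NPPLF.learningBound k σ (β (N + 1)) (fun i => x i ω) N) :
    (∀ ω, IsGreatest
      (Set.range fun P : Set.Icc Pmin Pmax =>
        Real.sqrt (β (N + 1)) * NPPLF.stdAfter k σ (fun i => x i ω) N P) (ξmax ω)) ∧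
    ENNReal.ofReal (1 - δ) ≤ μ {ω | ∀ P : Set.Icc Pmin Pmax,
      NPPLF.meanAfter k σ (fun i => x i ω) (fun i => y i ω) N P - ξmax ω ≤ V P ∧
      V P ≤ NPPLF.meanAfter k σ (fun i => x i ω) (fun i => y i ω) N P + ξmax ω} := by
  have : Nonempty (Set.Icc Pmin Pmax) := ⟨⟨Pmin, le_rfl, hbox⟩⟩
  have hN1 : 1 ≤ N := by
    have : (0 : ℝ) < N := by linarith
    exact Nat.one_le_iff_ne_zero.2 (by rintro rfl; simp at this)
  have hgreat : ∀ ω, IsGreatest (Set.range fun P : Set.Icc Pmin Pmax =>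
      Real.sqrt (β (N + 1)) * NPPLF.stdAfter k σ (fun i => x i ω) N P) (ξmax ω) := fun ω => by
    rw [hξ ω]
    exact NPPLF.isGreatest_learningBound hk_cont σ _ _ N
  refine ⟨hgreat, ?_⟩
  -- the feature map of the reproducing kernel Hilbert space
  have hkΦ : ∀ P Q : Set.Icc Pmin Pmax,
      k P Q = inner ℝ (RKHS.kerFun H P (1 : ℝ)) (RKHS.kerFun H Q (1 : ℝ)) := fun P Q => by
    rw [real_inner_comm, ← RKHS.kernel_inner, hk]
    simp
  have hVΦ : ∀ P : Set.Icc Pmin Pmax, V P = inner ℝ f (RKHS.kerFun H P (1 : ℝ)) := fun P => by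
    rw [← hf P, RKHS.inner_kerFun]
    simp
  have hnoise : ∀ i < N, Measurable[ℱ (i + 1)] (ε (i + 1)) ∧
      NPPLF.IsSubgaussianGiven (ℱ i) μ fun ω => σ⁻¹ * ε (i + 1) ω := by
    intro i hi
    rcases hε with h | h
    · obtain ⟨h1, h2, h3⟩ := h i hi
      exact ⟨h1, NPPLF.isSubgaussianGiven_of_gaussian (ℱ.le i) hσ (h1.mono (ℱ.le _) le_rfl) h2 h3⟩
    · obtain ⟨h1, h2, h3⟩ := h i hi
      exact ⟨h1, NPPLF.isSubgaussianGiven_of_bounded (ℱ.le i) hσ (h1.mono (ℱ.le _) le_rfl) h2 h3⟩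
  refine (NPPLF.measure_confidence_ge hk_cont hkΦ f hVΦ hδ0 hδ1 hN hσ hrun.measurable_query
    (fun i hi => (hnoise i hi).1) hrun.observe (fun i hi => (hnoise i hi).2)).trans
    (measure_mono fun ω hω P => ?_)
  have hle : Real.sqrt (β (N + 1)) * NPPLF.stdAfter k σ (fun i => x i ω) N P ≤ ξmax ω :=
    (hgreat ω).2 ⟨P, rfl⟩
  rw [hβ N hN1] at hle
  have := abs_le.1 ((hω P).trans hle)
  constructor <;> linarith [this.1, this.2]
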